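/- Let $d\ge 1$, let $\phi:\mathbb R^d\times\mathbb R^d\to\mathbb R$ be a $C^\infty$ function and let $\psi\in C_0^\infty(\mathbb R^{2d})$ be a (complex-valued) smooth compactly supported function. For $\lambda>0$ and $f,g:\mathbb R^d\to\mathbb C$ define $$M^\lambda_\phi(f,g)(x)=\int_{\mathbb R^d}\int_{\mathbb R^d} f(x-u)\,g(x-v)\,e^{2\pi i\lambda\phi(u,v)}\,\psi(u,v)\,du\,dv .$$ Suppose that the determinant of the $2d\times 2d$ Hessian matrix of $\phi$ (all second partial derivatives with respect to $(u,v)$) does not vanish at any point of the (closed) support of $\psi$. Then there is a constant $C>0$, depending only on $d$, $\phi$ and $\psi$, such that for every $\lambda>0$ and all $f,g\in L^2(\mathbb R^d)$ the integral defining $M^\lambda_\phi(f,g)(x)$ converges absolutely for every $x$, $M^\lambda_\phi(f,g)\in L^2(\mathbb R^d)$, and $$\|M^\lambda_\phi(f,g)\|_{L^2(\mathbb R^d)}\le C\,\lambda^{-d/2}\,\|f\|_{L^2(\mathbb R^d)}\,\|g\|_{L^2(\mathbb R^d)} .$$ -/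

import Mathlib

open MeasureTheory
open scoped ContDiff ENNReal

noncomputable section

/-- The coordinate directions of `ℝᵈ × ℝᵈ`, with coordinates `(u, v)`: the index `inl i` stands
for `uᵢ` and `inr i` for `vᵢ`. -/
def coordDir (d : ℕ) :
    Fin d ⊕ Fin d → EuclideanSpace ℝ (Fin d) × EuclideanSpace ℝ (Fin d) :=
  Sum.elim (fun i => (EuclideanSpace.single i 1, 0)) (fun i => (0, EuclideanSpace.single i 1))

/-- The `2d × 2d` Hessian matrix of `φ : ℝᵈ × ℝᵈ → ℝ` at the point `p`: its entries are the second
partial derivatives of `φ` with respect to all coordinates of `(u, v)`. -/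
def hessianMatrix {d : ℕ} (φ : EuclideanSpace ℝ (Fin d) × EuclideanSpace ℝ (Fin d) → ℝ)
    (p : EuclideanSpace ℝ (Fin d) × EuclideanSpace ℝ (Fin d)) :
    Matrix (Fin d ⊕ Fin d) (Fin d ⊕ Fin d) ℝ :=
  Matrix.of fun i j =>
    fderiv ℝ (fun q => fderiv ℝ φ q (coordDir d j)) p (coordDir d i)

/-- The integrand `f(x - u) g(x - v) e^{2 π i lam φ(u, v)} ψ(u, v)`, as a function of
`p = (u, v)`. -/
def oscIntegrand {d : ℕ} (φ : EuclideanSpace ℝ (Fin d) × EuclideanSpace ℝ (Fin d) → ℝ)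
    (ψ : EuclideanSpace ℝ (Fin d) × EuclideanSpace ℝ (Fin d) → ℂ) (lam : ℝ)
    (f g : EuclideanSpace ℝ (Fin d) → ℂ) (x : EuclideanSpace ℝ (Fin d))
    (p : EuclideanSpace ℝ (Fin d) × EuclideanSpace ℝ (Fin d)) : ℂ :=
  f (x - p.1) * g (x - p.2) *
    Complex.exp (2 * (Real.pi : ℂ) * Complex.I * (lam : ℂ) * (φ p : ℂ)) * ψ p

/-- The bilinear oscillatory integral operator
`M(f, g)(x) = ∫∫ f(x - u) g(x - v) e^{2 π i lam φ(u, v)} ψ(u, v) du dv`. -/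
def bilinearOsc {d : ℕ} (φ : EuclideanSpace ℝ (Fin d) × EuclideanSpace ℝ (Fin d) → ℝ)
    (ψ : EuclideanSpace ℝ (Fin d) × EuclideanSpace ℝ (Fin d) → ℂ) (lam : ℝ)
    (f g : EuclideanSpace ℝ (Fin d) → ℂ) (x : EuclideanSpace ℝ (Fin d)) : ℂ :=
  ∫ p : EuclideanSpace ℝ (Fin d) × EuclideanSpace ℝ (Fin d), oscIntegrand φ ψ lam f g x p

end

/-! Put `K = e^{2πiλφ} ψ` and use the coordinates `w = u - v` and `v`. The Fourier transform of
`M(f, g)` at `ζ` is then the integral over `w` of the transform of `v ↦ K(w + v, v)` at `ζ` times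
the transform of `y ↦ f(y - w) g(y)` at `ζ`. Cauchy-Schwarz in `w`, Plancherel for each fixed `w`,
and `∫∫ |f(y - w) g(y)|² dy dw = ‖f‖² ‖g‖²` reduce the theorem to one estimate on the kernel: the
partial transform of `K` along the diagonal has squared `L²(dw)` norm `O(λ^{-d})`, uniformly in `ζ`
(`eLpNorm_bilinearConv_sq_le`).

Expanding that square bounds it by the integral over `h` of the absolute correlation of `K` with its
translate by `(h, h)`; the frequency `ζ` survives only in a unimodular factor
(`lintegral_fourier_sq_le_correlation`). Where the Hessian is nondegenerate, the gradient of `φ(p) -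
φ(p + H)` has size comparable to `|H|`. Nonstationary phase, made uniform in `H` by dividing the
phase by `|H|`, bounds the correlation at `H` by a multiple of `(1 + λ|H|)^{-N}` if `ψ` has small
support (`exists_correlation_bound`). Taking `N = d + 1` and integrating over `h ∈ ℝᵈ` gives
`λ^{-d}`, whose square root is the claimed power. A finite partition of unity removes the
restriction on the support (`partialFourierDecay_of_nondegenerate`). -/

/-! ### Plancherel and Cauchy-Schwarz -/

open scoped FourierTransform SchwartzMap in
/-- On `L¹ ∩ L²` the `L²` Fourier transform is given by the Fourier integral. -/
theorem ae_eq_fourier_toLp {E : Type*} [NormedAddCommGroup E] [InnerProductSpace ℝ E]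
    [FiniteDimensional ℝ E] [MeasurableSpace E] [BorelSpace E] {G : E → ℂ}
    (h1 : Integrable G) (h2 : MemLp G 2) :
    ((𝓕 (h2.toLp G) : Lp (α := E) ℂ 2) : E → ℂ) =ᵐ[volume] 𝓕 G := by
  have hcont : Continuous (𝓕 G) :=
    VectorFourier.fourierIntegral_continuous Real.continuous_fourierChar
      (by exact continuous_inner) h1
  -- It suffices to test against smooth compactly supported functions. These are Schwartz, so both
  -- sides become pairings of `G` with the transform of the test function.
  apply ae_eq_of_integral_contDiff_smul_eq
  · exact (Lp.memLp _).locallyIntegrable (by norm_num)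
  · exact hcont.locallyIntegrable
  intro g hg hgc
  have hgC : HasCompactSupport (fun x => (g x : ℂ)) :=
    hgc.comp_left (g := fun r : ℝ => (r : ℂ)) (by simp)
  set s : 𝓢(E, ℂ) := hgC.toSchwartzMap (Complex.ofRealCLM.contDiff.comp hg) with hs
  have hsg : ∀ x, s x = (g x : ℂ) := fun x => rfl
  have key := congrArg (fun T => T s) (Lp.fourier_toTemperedDistribution_eq (h2.toLp G))
  simp only [TemperedDistribution.fourier_apply, Lp.toTemperedDistribution_apply] at key
  have e2 : ∫ x, (𝓕 s) x • (h2.toLp G : E → ℂ) x = ∫ x, (𝓕 s) x • G x := by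
    apply integral_congr_ae
    filter_upwards [h2.coeFn_toLp] with x hx
    rw [hx]
  simp only [hsg] at key
  simp only [← Complex.coe_smul (E := ℂ)] at key ⊢
  rw [← key, e2]
  have flip := VectorFourier.integral_fourierIntegral_smul_eq_flip (μ := (volume : Measure E))
    (ν := (volume : Measure E)) (L := innerₗ E) Real.continuous_fourierChar
    continuous_inner (f := (s : E → ℂ)) (g := G) s.integrable h1
  rw [flip_innerₗ] at flip
  calc _ = ∫ x, s x • 𝓕 G x := flip
    _ = _ := by simp [hsg]

open scoped FourierTransform in
/-- Plancherel's theorem on `L¹ ∩ L²`. -/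
theorem eLpNorm_fourier_eq {E : Type*} [NormedAddCommGroup E] [InnerProductSpace ℝ E]
    [FiniteDimensional ℝ E] [MeasurableSpace E] [BorelSpace E] {G : E → ℂ}
    (h1 : Integrable G) (h2 : MemLp G 2) :
    eLpNorm (𝓕 G) 2 = eLpNorm G 2 := by
  rw [← eLpNorm_congr_ae (ae_eq_fourier_toLp h1 h2), ← eLpNorm_congr_ae h2.coeFn_toLp,
    ← Lp.enorm_def, ← Lp.enorm_def, ← ofReal_norm, Lp.norm_fourier_eq, ofReal_norm]

theorem eLpNorm_two_sq {α F : Type*} [MeasurableSpace α] {μ : Measure α} [NormedAddCommGroup F]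
    (f : α → F) : eLpNorm f 2 μ ^ 2 = ∫⁻ x, ‖f x‖ₑ ^ 2 ∂μ := by
  rw [eLpNorm_eq_lintegral_rpow_enorm_toReal (by norm_num) (by norm_num), ← ENNReal.rpow_natCast,
    ← ENNReal.rpow_mul]
  simp

-- If `G` is not in `L²` the right side is infinite. This spares the later argument from checking
-- that `f(· - w) g` is square integrable for each `w`.
open scoped FourierTransform in
theorem lintegral_fourier_sq_le {E : Type*} [NormedAddCommGroup E] [InnerProductSpace ℝ E]
    [FiniteDimensional ℝ E] [MeasurableSpace E] [BorelSpace E] {G : E → ℂ}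
    (h1 : Integrable G) : ∫⁻ ζ, ‖𝓕 G ζ‖ₑ ^ 2 ≤ ∫⁻ x, ‖G x‖ₑ ^ 2 := by
  by_cases h : eLpNorm G 2 = ⊤
  · rw [← eLpNorm_two_sq G, h]; simp
  · rw [← eLpNorm_two_sq, ← eLpNorm_two_sq,
      eLpNorm_fourier_eq h1 ⟨h1.1, lt_top_iff_ne_top.2 h⟩]

/-- The Cauchy-Schwarz inequality for the Lebesgue integral. -/
theorem lintegral_mul_sq_le {α : Type*} [MeasurableSpace α] {μ : Measure α} {f g : α → ℝ≥0∞}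
    (hf : AEMeasurable f μ) (hg : AEMeasurable g μ) :
    (∫⁻ a, f a * g a ∂μ) ^ 2 ≤ (∫⁻ a, f a ^ 2 ∂μ) * ∫⁻ a, g a ^ 2 ∂μ := by
  have h := ENNReal.lintegral_mul_le_Lp_mul_Lq μ Real.HolderConjugate.two_two hf hg
  have h2 := pow_le_pow_left₀ (zero_le) h 2
  rw [mul_pow, ← ENNReal.rpow_natCast, ← ENNReal.rpow_natCast, ← ENNReal.rpow_natCast,
    ← ENNReal.rpow_mul, ← ENNReal.rpow_mul] at h2
  simpa using h2

theorem stronglyMeasurable_translates {E : Type*} [NormedAddCommGroup E]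
    [MeasurableSpace E] [BorelSpace E] [SecondCountableTopology E] {f g : E → ℂ} (hf : StronglyMeasurable f)
    (hg : StronglyMeasurable g) (x : E) :
    StronglyMeasurable fun p : E × E => f (x - p.1) * g (x - p.2) :=
  (hf.comp_measurable (by fun_prop)).mul (hg.comp_measurable (by fun_prop))

/-! ### Bilinear convolution on the Fourier side -/

section Translates

variable {E : Type*} [NormedAddCommGroup E] [InnerProductSpace ℝ E]
  [FiniteDimensional ℝ E] [MeasurableSpace E] [BorelSpace E]

theorem lintegral_translates_sq {f g : E → ℂ} (hf : StronglyMeasurable f)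
    (hg : StronglyMeasurable g) (x : E) :
    ∫⁻ p : E × E, ‖f (x - p.1) * g (x - p.2)‖ₑ ^ 2 =
      eLpNorm f 2 ^ 2 * eLpNorm g 2 ^ 2 := by
  simp only [enorm_mul, mul_pow]
  rw [Measure.volume_eq_prod, lintegral_prod_mul (f := fun u => ‖f (x - u)‖ₑ ^ 2)
    (g := fun v => ‖g (x - v)‖ₑ ^ 2), lintegral_sub_left_eq_self (fun u => ‖f u‖ₑ ^ 2),
    lintegral_sub_left_eq_self (fun u => ‖g u‖ₑ ^ 2), eLpNorm_two_sq, eLpNorm_two_sq]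
  · exact ((hf.comp_measurable (measurable_const_sub x)).enorm.pow_const 2).aemeasurable
  · exact ((hg.comp_measurable (measurable_const_sub x)).enorm.pow_const 2).aemeasurable

theorem memLp_translates {f g : E → ℂ} (hf : StronglyMeasurable f)
    (hg : StronglyMeasurable g) (hf2 : MemLp f 2) (hg2 : MemLp g 2) (x : E) :
    MemLp (fun p : E × E => f (x - p.1) * g (x - p.2)) 2 := by
  refine ⟨(stronglyMeasurable_translates hf hg x).aestronglyMeasurable, ?_⟩
  refine (ENNReal.pow_lt_top_iff (n := 2)).1 ?_ |>.resolve_right two_ne_zero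
  rw [eLpNorm_two_sq, lintegral_translates_sq hf hg x]
  exact ENNReal.mul_lt_top (ENNReal.pow_lt_top hf2.2) (ENNReal.pow_lt_top hg2.2)

theorem integrable_translates_mul {f g : E → ℂ} (hf : StronglyMeasurable f)
    (hg : StronglyMeasurable g) (hf2 : MemLp f 2) (hg2 : MemLp g 2) {K : E × E → ℂ}
    (hK : Continuous K) (hKc : HasCompactSupport K) (x : E) :
    Integrable fun p : E × E => f (x - p.1) * g (x - p.2) * K p :=
  MemLp.integrable_mul (p := 2) (q := 2) (memLp_translates hf hg hf2 hg2 x)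
    (hK.memLp_of_hasCompactSupport hKc)

/-- The bilinear convolution operator with kernel `K`. -/
noncomputable def bilinearConv (K : E × E → ℂ) (f g : E → ℂ) (x : E) : ℂ :=
  ∫ p : E × E, f (x - p.1) * g (x - p.2) * K p

/-- Cauchy-Schwarz on the product space. The bound has no decay in the frequency; it serves only to
show that the output is bounded. -/
theorem enorm_bilinearConv_sq_le {f g : E → ℂ} (hf : StronglyMeasurable f)
    (hg : StronglyMeasurable g) {K : E × E → ℂ} (hK : Continuous K) (x : E) :
    ‖bilinearConv K f g x‖ₑ ^ 2 ≤ eLpNorm f 2 ^ 2 * eLpNorm g 2 ^ 2 * eLpNorm K 2 ^ 2 := by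
  calc ‖bilinearConv K f g x‖ₑ ^ 2
      ≤ (∫⁻ p : E × E, ‖f (x - p.1) * g (x - p.2)‖ₑ * ‖K p‖ₑ) ^ 2 := by
        gcongr
        refine (enorm_integral_le_lintegral_enorm _).trans_eq ?_
        simp only [enorm_mul]
    _ ≤ _ := lintegral_mul_sq_le (stronglyMeasurable_translates hf hg x).enorm.aemeasurable
        hK.enorm.measurable.aemeasurable
    _ = _ := by rw [lintegral_translates_sq hf hg, eLpNorm_two_sq K]

/-- The integrand of `bilinearConv K f g x` in the coordinates `q = (u - v, v)`. -/
def shearedIntegrand (K : E × E → ℂ) (f g : E → ℂ) (q : E × E) (x : E) : ℂ :=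
  f (x - (q.1 + q.2)) * g (x - q.2) * K (q.1 + q.2, q.2)

theorem bilinearConv_eq (K : E × E → ℂ) (hK : Continuous K) {f g : E → ℂ}
    (hf : StronglyMeasurable f) (hg : StronglyMeasurable g) (x : E) :
    bilinearConv K f g x = ∫ q, shearedIntegrand K f g q x := by
  have hS := measurePreserving_add_prod (volume : Measure E) (volume : Measure E)
  rw [bilinearConv, Measure.volume_eq_prod, ← hS.map_eq, integral_map]
  · rw [hS.map_eq]; rfl
  · exact hS.measurable.aemeasurable
  · exact ((stronglyMeasurable_translates hf hg x).mul
      hK.stronglyMeasurable).aestronglyMeasurable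

theorem stronglyMeasurable_shearedIntegrand {K : E × E → ℂ} (hK : Continuous K) {f g : E → ℂ}
    (hf : StronglyMeasurable f) (hg : StronglyMeasurable g) :
    StronglyMeasurable (Function.uncurry (shearedIntegrand K f g)) :=
  ((hf.comp_measurable (g := fun z : (E × E) × E => z.2 - (z.1.1 + z.1.2)) (by fun_prop)).mul
    (hg.comp_measurable (g := fun z : (E × E) × E => z.2 - z.1.2) (by fun_prop))).mul
    (hK.stronglyMeasurable.comp_measurable
      (g := fun z : (E × E) × E => (z.1.1 + z.1.2, z.1.2)) (by fun_prop))

/-- This justifies every use of Fubini below. Integrating in `x` first, Cauchy-Schwarz bounds the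
product of translates by `‖f‖ ‖g‖`, leaving the integral of `|K|`. -/
theorem integrable_shearedIntegrand {K : E × E → ℂ} (hK : Continuous K)
    (hKc : HasCompactSupport K) {f g : E → ℂ}
    (hf : StronglyMeasurable f) (hg : StronglyMeasurable g) (hf2 : MemLp f 2) (hg2 : MemLp g 2) :
    Integrable (Function.uncurry (shearedIntegrand K f g)) := by
  have hm := stronglyMeasurable_shearedIntegrand hK hf hg
  refine ⟨hm.aestronglyMeasurable, ?_⟩
  have hS := measurePreserving_add_prod (volume : Measure E) (volume : Measure E)
  have hKi : ∫⁻ q : E × E, ‖K (q.1 + q.2, q.2)‖ₑ < ⊤ := by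
    rw [Measure.volume_eq_prod, hS.lintegral_comp (f := fun p => ‖K p‖ₑ) hK.enorm.measurable]
    exact (hK.integrable_of_hasCompactSupport hKc).2
  have hfg : eLpNorm f 2 * eLpNorm g 2 < ⊤ := ENNReal.mul_lt_top hf2.2 hg2.2
  unfold HasFiniteIntegral
  rw [Measure.volume_eq_prod, lintegral_prod _ hm.enorm.aemeasurable]
  calc _ ≤ ∫⁻ q : E × E, (eLpNorm f 2 * eLpNorm g 2) * ‖K (q.1 + q.2, q.2)‖ₑ := by
        refine lintegral_mono fun q => ?_
        simp only [Function.uncurry, shearedIntegrand, enorm_mul]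
        rw [lintegral_mul_const']
        · gcongr
          rw [← ENNReal.pow_le_pow_left_iff (n := 2) (by norm_num), mul_pow, eLpNorm_two_sq,
            eLpNorm_two_sq, ← lintegral_sub_right_eq_self (fun u => ‖f u‖ₑ ^ 2) (q.1 + q.2),
            ← lintegral_sub_right_eq_self (fun u => ‖g u‖ₑ ^ 2) q.2]
          exact lintegral_mul_sq_le
            (hf.comp_measurable (measurable_sub_const _)).enorm.aemeasurable
            (hg.comp_measurable (measurable_sub_const _)).enorm.aemeasurable
        · simp
    _ < ⊤ := by
        rw [lintegral_const_mul' _ _ hfg.ne]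
        exact ENNReal.mul_lt_top hfg hKi

theorem integrable_bilinearConv {K : E × E → ℂ} (hK : Continuous K)
    (hKc : HasCompactSupport K) {f g : E → ℂ}
    (hf : StronglyMeasurable f) (hg : StronglyMeasurable g) (hf2 : MemLp f 2) (hg2 : MemLp g 2) :
    Integrable (bilinearConv K f g) := by
  simp only [funext (bilinearConv_eq K hK hf hg)]
  exact (integrable_shearedIntegrand hK hKc hf hg hf2 hg2).integral_prod_right

/-- The output is integrable and bounded, hence square integrable. Plancherel needs this qualitative
fact before the sharp bound can be proved. -/
theorem memLp_bilinearConv {K : E × E → ℂ} (hK : Continuous K)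
    (hKc : HasCompactSupport K) {f g : E → ℂ}
    (hf : StronglyMeasurable f) (hg : StronglyMeasurable g) (hf2 : MemLp f 2) (hg2 : MemLp g 2) :
    MemLp (bilinearConv K f g) 2 := by
  have h1 := integrable_bilinearConv hK hKc hf hg hf2 hg2
  have hK2 : MemLp K 2 := hK.memLp_of_hasCompactSupport hKc
  set N : ℝ≥0∞ := eLpNorm f 2 * eLpNorm g 2 * eLpNorm K 2 with hN
  have hNt : N < ⊤ := ENNReal.mul_lt_top (ENNReal.mul_lt_top hf2.2 hg2.2) hK2.2
  refine ⟨h1.1, ?_⟩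
  refine (ENNReal.pow_lt_top_iff (n := 2)).1 ?_ |>.resolve_right two_ne_zero
  rw [eLpNorm_two_sq]
  calc _ ≤ ∫⁻ x, N * ‖bilinearConv K f g x‖ₑ := by
        refine lintegral_mono fun x => ?_
        rw [sq]
        gcongr
        rw [← ENNReal.pow_le_pow_left_iff (n := 2) (by norm_num), hN, mul_pow, mul_pow]
        exact enorm_bilinearConv_sq_le hf hg hK x
    _ < ⊤ := by
        rw [lintegral_const_mul' _ _ hNt.ne]
        exact ENNReal.mul_lt_top hNt h1.2

open scoped FourierTransform

theorem fourier_comp_sub (G : E → ℂ) (v ζ : E) :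
    𝓕 (fun x => G (x - v)) ζ = Real.fourierChar (-inner ℝ v ζ) • 𝓕 G ζ := by
  have h := congrFun (VectorFourier.fourierIntegral_comp_add_right Real.fourierChar
    (volume : Measure E) (innerₗ E) G (-v)) ζ
  simp only [innerₗ_apply_apply, inner_neg_left] at h
  simp only [sub_eq_add_neg]
  exact h

/-- The Fourier transform of `bilinearConv K f g` as a superposition of products. -/
theorem fourier_bilinearConv {K : E × E → ℂ} (hK : Continuous K)
    (hKc : HasCompactSupport K) {f g : E → ℂ}
    (hf : StronglyMeasurable f) (hg : StronglyMeasurable g) (hf2 : MemLp f 2) (hg2 : MemLp g 2)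
    (ζ : E) :
    𝓕 (bilinearConv K f g) ζ =
      ∫ w, 𝓕 (fun v => K (w + v, v)) ζ * 𝓕 (fun y => f (y - w) * g y) ζ := by
  have hJ := integrable_shearedIntegrand hK hKc hf hg hf2 hg2
  have hJe : Integrable (Function.uncurry fun (q : E × E) (x : E) =>
      Real.fourierChar (-inner ℝ x ζ) • shearedIntegrand K f g q x) := by
    refine hJ.mono ?_ (Filter.Eventually.of_forall fun z => by simp [Function.uncurry])
    refine AEStronglyMeasurable.smul (f := fun z : (E × E) × E =>
      Real.fourierChar (-inner ℝ z.2 ζ)) ?_ hJ.1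
    exact (Real.continuous_fourierChar.comp (by fun_prop)).aestronglyMeasurable
  -- For fixed `(w, v)` the `x`-dependence is a translate by `v` of `f(· - w) g`. Thus `v` enters
  -- only through a character and `K`, and integrating it out leaves the partial transform of `K`.
  have hinner (q : E × E) :
      ∫ x, Real.fourierChar (-inner ℝ x ζ) • shearedIntegrand K f g q x =
        (Real.fourierChar (-inner ℝ q.2 ζ) • K (q.1 + q.2, q.2)) *
          𝓕 (fun y => f (y - q.1) * g y) ζ := by
    have h := fourier_comp_sub (fun y => f (y - q.1) * g y) q.2 ζ
    rw [smul_mul_assoc, mul_comm (K _), ← smul_mul_assoc, ← h, Real.fourier_eq,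
      ← integral_mul_const]
    congr 1 with x
    simp only [shearedIntegrand, smul_mul_assoc, sub_sub, add_comm q.1 q.2]
  rw [Real.fourier_eq]
  have hpull (x : E) : Real.fourierChar (-inner ℝ x ζ) • ∫ q, shearedIntegrand K f g q x =
      ∫ q, Real.fourierChar (-inner ℝ x ζ) • shearedIntegrand K f g q x := by
    simp only [Circle.smul_def, integral_smul]
  simp only [bilinearConv_eq K hK hf hg, hpull]
  rw [Measure.volume_eq_prod] at hJe
  rw [← integral_integral_swap hJe]
  simp only [hinner]
  have hint := hJe.integral_prod_left
  simp only [Function.uncurry, hinner] at hint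
  rw [Measure.volume_eq_prod] at hint ⊢
  rw [integral_prod _ hint]
  simp only [integral_mul_const, Real.fourier_eq]

theorem lintegral_translates_mul_sq {f g : E → ℂ} (hf : StronglyMeasurable f)
    (hg : StronglyMeasurable g) :
    ∫⁻ w, ∫⁻ y, ‖f (y - w) * g y‖ₑ ^ 2 = eLpNorm f 2 ^ 2 * eLpNorm g 2 ^ 2 := by
  rw [lintegral_lintegral_swap]
  · simp only [enorm_mul, mul_pow]
    have (y : E) : ∫⁻ w, ‖f (y - w)‖ₑ ^ 2 * ‖g y‖ₑ ^ 2 = eLpNorm f 2 ^ 2 * ‖g y‖ₑ ^ 2 := by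
      rw [lintegral_mul_const' _ _ (by simp), lintegral_sub_left_eq_self (fun u => ‖f u‖ₑ ^ 2),
        eLpNorm_two_sq]
    simp only [this]
    rw [lintegral_const_mul _ (hg.enorm.pow_const 2), eLpNorm_two_sq g]
  · exact (((hf.comp_measurable (g := fun z : E × E => z.2 - z.1) (by fun_prop)).mul
      (hg.comp_measurable measurable_snd)).enorm.pow_const 2).aemeasurable

theorem stronglyMeasurable_fourier_slice {K : E × E → ℂ} (hK : Continuous K) :
    StronglyMeasurable (fun z : E × E => 𝓕 (fun v => K (z.2 + v, v)) z.1) := by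
  simp only [Real.fourier_eq]
  refine StronglyMeasurable.integral_prod_right
    (f := fun z : E × E => fun v => Real.fourierChar (-inner ℝ v z.1) • K (z.2 + v, v)) ?_
  refine StronglyMeasurable.smul (f := fun t : (E × E) × E =>
    Real.fourierChar (-inner ℝ t.2 t.1.1)) ?_ ?_
  · exact (Real.continuous_fourierChar.comp (by fun_prop)).stronglyMeasurable
  · exact (hK.comp (by fun_prop)).stronglyMeasurable

/-- An `L² × L² → L²` bound from a uniform bound on the partial Fourier transforms of the kernel
along the diagonal direction. -/
theorem eLpNorm_bilinearConv_sq_le {K : E × E → ℂ} (hK : Continuous K)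
    (hKc : HasCompactSupport K) {B : ℝ≥0∞}
    (hB : ∀ ζ : E, ∫⁻ w, ‖𝓕 (fun v => K (w + v, v)) ζ‖ₑ ^ 2 ≤ B) {f g : E → ℂ}
    (hf : StronglyMeasurable f) (hg : StronglyMeasurable g) (hf2 : MemLp f 2) (hg2 : MemLp g 2) :
    eLpNorm (bilinearConv K f g) 2 ^ 2 ≤ B * (eLpNorm f 2 ^ 2 * eLpNorm g 2 ^ 2) := by
  have hG : StronglyMeasurable (fun z : E × E => 𝓕 (fun y => f (y - z.2) * g y) z.1) := by
    simp only [Real.fourier_eq]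
    refine StronglyMeasurable.integral_prod_right
      (f := fun z : E × E => fun y => Real.fourierChar (-inner ℝ y z.1) • (f (y - z.2) * g y)) ?_
    refine StronglyMeasurable.smul (f := fun t : (E × E) × E =>
      Real.fourierChar (-inner ℝ t.2 t.1.1)) ?_ ?_
    · exact (Real.continuous_fourierChar.comp (by fun_prop)).stronglyMeasurable
    · exact (hf.comp_measurable (g := fun t : (E × E) × E => t.2 - t.1.2) (by fun_prop)).mul
        (hg.comp_measurable measurable_snd)
  have hKm := stronglyMeasurable_fourier_slice hK
  have hGi (w : E) : Integrable fun y => f (y - w) * g y :=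
    MemLp.integrable_mul (p := 2) (q := 2)
      (hf2.comp_measurePreserving (measurePreserving_sub_right volume w)) hg2
  rw [← eLpNorm_fourier_eq (integrable_bilinearConv hK hKc hf hg hf2 hg2)
    (memLp_bilinearConv hK hKc hf hg hf2 hg2), eLpNorm_two_sq]
  calc ∫⁻ ζ, ‖𝓕 (bilinearConv K f g) ζ‖ₑ ^ 2
      ≤ ∫⁻ ζ, B * ∫⁻ w, ‖𝓕 (fun y => f (y - w) * g y) ζ‖ₑ ^ 2 := by
        refine lintegral_mono fun ζ => ?_
        rw [fourier_bilinearConv hK hKc hf hg hf2 hg2]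
        calc _ ≤ (∫⁻ w, ‖𝓕 (fun v => K (w + v, v)) ζ‖ₑ *
              ‖𝓕 (fun y => f (y - w) * g y) ζ‖ₑ) ^ 2 := by
              gcongr
              refine (enorm_integral_le_lintegral_enorm _).trans_eq ?_
              simp only [enorm_mul]
          _ ≤ _ := lintegral_mul_sq_le
              (hKm.comp_measurable (measurable_prodMk_left (x := ζ))).enorm.aemeasurable
              (hG.comp_measurable (measurable_prodMk_left (x := ζ))).enorm.aemeasurable
          _ ≤ _ := by gcongr; exact hB ζ
    _ = B * ∫⁻ w, ∫⁻ ζ, ‖𝓕 (fun y => f (y - w) * g y) ζ‖ₑ ^ 2 := by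
        have hG2 := hG.enorm.pow_const 2
        rw [lintegral_const_mul _ hG2.lintegral_prod_right',
          lintegral_lintegral_swap hG2.aemeasurable]
    _ ≤ B * ∫⁻ w, ∫⁻ y, ‖f (y - w) * g y‖ₑ ^ 2 := by
        refine mul_le_mul' le_rfl (lintegral_mono fun w => ?_)
        exact lintegral_fourier_sq_le (hGi w)
    _ = _ := by rw [lintegral_translates_mul_sq hf hg]

end Translates

/-! ### Smooth families with uniform derivative bounds -/

section UniformSmooth

variable {ι V W : Type*} [NormedAddCommGroup V] [NormedSpace ℝ V]
  [NormedAddCommGroup W] [NormedSpace ℝ W]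

/-- A family of smooth functions all of whose derivatives are bounded on `S`, uniformly in the
index of the family. -/
structure UniformSmooth (S : Set V) (F : ι → V → W) : Prop where
  contDiff : ∀ i, ContDiff ℝ ∞ (F i)
  bound : ∀ k : ℕ, ∃ C : ℝ, ∀ i, ∀ p ∈ S, ‖iteratedFDeriv ℝ k (F i) p‖ ≤ C

theorem ContDiff.exists_iteratedFDeriv_bound {G : V → W} (hG : ContDiff ℝ ∞ G) {S : Set V}
    (hS : IsCompact S) (k : ℕ) : ∃ C : ℝ, ∀ p ∈ S, ‖iteratedFDeriv ℝ k G p‖ ≤ C :=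
  hS.exists_bound_of_continuousOn
    (hG.continuous_iteratedFDeriv (by exact_mod_cast le_top)).continuousOn

theorem UniformSmooth.smul {𝕜 : Type*} [NormedField 𝕜] [NormedAlgebra ℝ 𝕜] [NormedSpace 𝕜 W]
    [IsScalarTower ℝ 𝕜 W] {S : Set V} {Q : ι → V → 𝕜} {F : ι → V → W}
    (hQ : UniformSmooth S Q) (hF : UniformSmooth S F) :
    UniformSmooth S fun i p => Q i p • F i p := by
  refine ⟨fun i => (hQ.contDiff i).smul (hF.contDiff i), fun k => ?_⟩
  choose A hA using hQ.bound
  choose B hB using hF.bound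
  refine ⟨∑ j ∈ Finset.range (k + 1), (k.choose j : ℝ) * A j * B (k - j), fun i p hp => ?_⟩
  refine (norm_iteratedFDeriv_smul_le (hQ.contDiff i) (hF.contDiff i) p
    (n := k) (by exact_mod_cast le_top)).trans ?_
  refine Finset.sum_le_sum fun j _ => ?_
  have hA0 : 0 ≤ A j := (norm_nonneg _).trans (hA j i p hp)
  gcongr
  · exact hA j i p hp
  · exact hB (k - j) i p hp

theorem UniformSmooth.fderiv_apply {S : Set V} {F : ι → V → W} (hF : UniformSmooth S F)
    {e : ι → V} (he : ∀ i, ‖e i‖ ≤ 1) :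
    UniformSmooth S fun i p => fderiv ℝ (F i) p (e i) := by
  have h1 (i : ι) : ContDiff ℝ ∞ (fderiv ℝ (F i)) := (hF.contDiff i).fderiv_right (by simp)
  refine ⟨fun i => (h1 i).clm_apply contDiff_const, fun k => ?_⟩
  obtain ⟨C, hC⟩ := hF.bound (k + 1)
  refine ⟨C, fun i p hp => ?_⟩
  refine (norm_iteratedFDeriv_clm_apply_const (c := e i) (h1 i).contDiffAt
    (by exact_mod_cast le_top)).trans ?_
  rw [norm_iteratedFDeriv_fderiv]
  exact (mul_le_of_le_one_left (norm_nonneg _) (he i)).trans (hC i p hp)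

theorem UniformSmooth.comp_left {S : Set V} {g : ι → V → ℝ} (hg : UniformSmooth S g)
    {q : ℝ → W} (hq : ContDiff ℝ ∞ q) : UniformSmooth S fun i => q ∘ g i := by
  refine ⟨fun i => hq.comp (hg.contDiff i), fun k => ?_⟩
  choose A hA using hg.bound
  -- All values of the family on `S` lie in this one compact interval, so the bounds on the
  -- derivatives of `q` do not depend on the index.
  choose B hB using hq.exists_iteratedFDeriv_bound (isCompact_Icc (a := -A 0) (b := A 0))
  -- The composition estimate wants the `j`-th derivative bounded by `D ^ j`. With `D ≥ 1` it is
  -- enough that `D` dominates each `A j`.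
  have hD1 : (1 : ℝ) ≤ 1 + ∑ j ∈ Finset.range (k + 1), |A j| :=
    le_add_of_nonneg_right (Finset.sum_nonneg fun j _ => abs_nonneg _)
  refine ⟨k.factorial * (∑ j ∈ Finset.range (k + 1), |B j|) *
    (1 + ∑ j ∈ Finset.range (k + 1), |A j|) ^ k, fun i p hp => ?_⟩
  have hmem : g i p ∈ Set.Icc (-A 0) (A 0) := by
    have := hA 0 i p hp
    rw [norm_iteratedFDeriv_zero] at this
    exact abs_le.1 this
  refine norm_iteratedFDeriv_comp_le hq (hg.contDiff i) (by exact_mod_cast le_top) p ?_ ?_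
  · intro j hj
    refine (hB j _ hmem).trans ((le_abs_self _).trans ?_)
    exact Finset.single_le_sum (f := fun j => |B j|) (fun _ _ => abs_nonneg _)
      (Finset.mem_range.2 (by omega))
  · intro j hj1 hj
    refine (hA j i p hp).trans ((le_abs_self _).trans ?_)
    refine le_trans ?_ (le_self_pow₀ hD1 (by omega))
    refine le_trans ?_ (le_add_of_nonneg_left zero_le_one)
    exact Finset.single_le_sum (f := fun j => |A j|) (fun _ _ => abs_nonneg _)
      (Finset.mem_range.2 (by omega))

end UniformSmooth

/-- A smooth function on the line which agrees with `y ↦ y⁻¹` on `[c, ∞)`. -/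
theorem exists_contDiff_eq_inv {c : ℝ} (hc : 0 < c) :
    ∃ q : ℝ → ℝ, ContDiff ℝ ∞ q ∧ ∀ y, c ≤ y → y * q y = 1 := by
  -- The glue term vanishes once `|y| ≥ c` and is positive at `y = 0`, so the denominator never
  -- vanishes and the quotient is `1 / y` on `[c, ∞)`.
  refine ⟨fun y => y / (y ^ 2 + expNegInvGlue (c ^ 2 - y ^ 2)), ?_, fun y hy => ?_⟩
  · refine contDiff_id.div ((contDiff_id.pow 2).add
      (expNegInvGlue.contDiff.comp (contDiff_const.sub (contDiff_id.pow 2)))) fun y => ?_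
    rcases eq_or_ne y 0 with rfl | hy
    · have : 0 < expNegInvGlue (c ^ 2) := expNegInvGlue.pos_of_pos (by positivity)
      simpa using this.ne'
    · have : 0 < y ^ 2 := by positivity
      exact (add_pos_of_pos_of_nonneg this (expNegInvGlue.nonneg _)).ne'
  · have hy0 : 0 < y := hc.trans_le hy
    have : expNegInvGlue (c ^ 2 - y ^ 2) = 0 :=
      expNegInvGlue.zero_of_nonpos (by nlinarith)
    simp only [this, add_zero]
    field_simp

/-! ### Nonstationary phase -/

section Nonstationary

variable {ι V : Type*} [NormedAddCommGroup V] [NormedSpace ℝ V] [FiniteDimensional ℝ V]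
  [MeasurableSpace V] [BorelSpace V] {μ : Measure V} [μ.IsAddHaarMeasure]

/-- Integration by parts for an oscillatory integral. -/
theorem integral_exp_mul_fderiv {θ : V → ℝ} (hθ : ContDiff ℝ ∞ θ) {f : V → ℂ}
    (hf : ContDiff ℝ ∞ f) (hfc : HasCompactSupport f) (e : V) (t : ℝ) :
    Complex.I * t * ∫ p, Complex.exp (Complex.I * t * θ p) * ((fderiv ℝ θ p e : ℝ) • f p) ∂μ =
      - ∫ p, Complex.exp (Complex.I * t * θ p) * fderiv ℝ f p e ∂μ := by
  set X : V → ℂ := fun p => Complex.exp (Complex.I * t * θ p) with hX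
  have hXs : ContDiff ℝ ∞ X :=
    Complex.contDiff_exp.comp (contDiff_const.mul (Complex.ofRealCLM.contDiff.comp hθ))
  have hXd (p : V) : fderiv ℝ X p e = X p * (Complex.I * t * (fderiv ℝ θ p e : ℝ)) := by
    have h1 : HasFDerivAt θ (fderiv ℝ θ p) p :=
      (hθ.differentiable (by simp) p).hasFDerivAt
    have h2 := ((Complex.ofRealCLM.hasFDerivAt.comp p h1).const_mul (Complex.I * t)).cexp
    have h3 : HasFDerivAt X _ p := h2
    rw [h3.fderiv]
    simp [hX]
  have hX' : Continuous fun p => fderiv ℝ X p e :=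
    (hXs.continuous_fderiv (by simp)).clm_apply continuous_const
  have hf' : Continuous fun p => fderiv ℝ f p e :=
    (hf.continuous_fderiv (by simp)).clm_apply continuous_const
  have hfc' : HasCompactSupport fun p => fderiv ℝ f p e := hfc.fderiv_apply (𝕜 := ℝ) e
  have key := integral_mul_fderiv_eq_neg_fderiv_mul_of_integrable (μ := μ) (f := X) (g := f) (v := e)
    ((hX'.mul hf.continuous).integrable_of_hasCompactSupport hfc.mul_left)
    ((hXs.continuous.mul hf').integrable_of_hasCompactSupport hfc'.mul_left)
    ((hXs.continuous.mul hf.continuous).integrable_of_hasCompactSupport hfc.mul_left)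
    (fun p _ => hXs.differentiable (by simp) p) (fun p _ => hf.differentiable (by simp) p)
  rw [key, neg_neg, ← integral_const_mul]
  congr 1 with p
  rw [hXd, Complex.real_smul]
  ring

/-- Nonstationary phase, uniformly over a family of phases and amplitudes: if the derivative of
the phase `θ i` in the direction `e i` is bounded below on `S`, then the oscillatory integrals
decay faster than any power of the frequency. -/
theorem exists_bound_integral_exp_of_le_fderiv {S : Set V} (hS : IsCompact S) {θ : ι → V → ℝ}
    (hθ : ∀ i, ContDiff ℝ ∞ (θ i)) {e : ι → V} (he : ∀ i, ‖e i‖ ≤ 1)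
    (hg : UniformSmooth S fun i p => fderiv ℝ (θ i) p (e i)) {c : ℝ} (hc : 0 < c)
    (hgc : ∀ i, ∀ p ∈ S, c ≤ fderiv ℝ (θ i) p (e i)) (N : ℕ) {f : ι → V → ℂ}
    (hf : UniformSmooth S f) (hfS : ∀ i, tsupport (f i) ⊆ S) :
    ∃ C : ℝ, ∀ i, ∀ t : ℝ, 0 < t →
      t ^ N * ‖∫ p, Complex.exp (Complex.I * t * θ i p) * f i p ∂μ‖ ≤ C := by
  obtain ⟨q, hq, hqi⟩ := exists_contDiff_eq_inv hc
  induction N generalizing f with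
  | zero =>
    obtain ⟨C, hC⟩ := hf.bound 0
    refine ⟨C * μ.real S, fun i t _ => ?_⟩
    rw [pow_zero, one_mul, ← setIntegral_eq_integral_of_forall_compl_eq_zero (s := S)]
    · refine norm_setIntegral_le_of_norm_le_const hS.measure_lt_top fun p hp => ?_
      have h1 := hC i p hp
      rw [norm_iteratedFDeriv_zero] at h1
      rw [norm_mul, mul_assoc, mul_comm Complex.I, ← Complex.ofReal_mul,
        Complex.norm_exp_ofReal_mul_I, one_mul]
      exact h1
    · intro p hp
      rw [image_eq_zero_of_notMem_tsupport fun h => hp (hfS i h), mul_zero]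
  | succ N ih =>
    -- The amplitude is divided by the directional derivative of the phase, with `q` as a globally
    -- smooth reciprocal. One integration by parts then gains a factor `t⁻¹`, and the new amplitudes
    -- again form a uniformly smooth family supported in `S`.
    have hQ := (hg.comp_left hq).smul hf
    have hsupp (i : ι) : tsupport (fun p => (q ∘ fun p => fderiv ℝ (θ i) p (e i)) p • f i p) ⊆
        tsupport (f i) := tsupport_smul_subset_right _ _
    obtain ⟨C, hC⟩ := ih (hQ.fderiv_apply he)
      fun i => (tsupport_fderiv_apply_subset ℝ (e i)).trans ((hsupp i).trans (hfS i))
    refine ⟨C, fun i t ht => ?_⟩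
    have hcs : HasCompactSupport fun p =>
        (q ∘ fun p => fderiv ℝ (θ i) p (e i)) p • f i p :=
      hS.of_isClosed_subset (isClosed_tsupport _) ((hsupp i).trans (hfS i))
    have key := integral_exp_mul_fderiv (μ := μ) (hθ i) (hQ.contDiff i) hcs (e i) t
    have hfe (p : V) : (fderiv ℝ (θ i) p (e i)) •
        ((q ∘ fun p => fderiv ℝ (θ i) p (e i)) p • f i p) = f i p := by
      by_cases hp : p ∈ S
      · rw [smul_smul, Function.comp_apply, hqi _ (hgc i p hp), one_smul]
      · rw [image_eq_zero_of_notMem_tsupport fun h => hp (hfS i h), smul_zero, smul_zero]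
    simp only [hfe] at key
    have hn := congrArg norm key
    rw [norm_neg, norm_mul, norm_mul, Complex.norm_I, one_mul, Complex.norm_real,
      Real.norm_of_nonneg ht.le] at hn
    rw [pow_succ, mul_assoc, hn]
    exact hC i t ht

end Nonstationary

/-! ### Correlations of the oscillatory kernel -/

theorem Continuous.exists_ball_norm_sub_lt {V W : Type*} [NormedAddCommGroup V]
    [NormedAddCommGroup W] {G : V → W} (hG : Continuous G) (p₀ : V) {ε : ℝ} (hε : 0 < ε) :
    ∃ δ > 0, ∀ x ∈ Metric.ball p₀ δ, ‖G x - G p₀‖ < ε :=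
  Metric.eventually_nhds_iff_ball.1 <|
    ((hG.sub continuous_const).norm.continuousAt (x := p₀)).eventually_lt continuousAt_const
      (show _ < ε by simpa using hε)

/-- The oscillatory kernel `e^{2 π i lam φ} ψ`. -/
noncomputable def oscKernel {V : Type*} (φ : V → ℝ) (ψ : V → ℂ) (lam : ℝ) (p : V) : ℂ :=
  Complex.exp (2 * (Real.pi : ℂ) * Complex.I * (lam : ℂ) * (φ p : ℂ)) * ψ p

theorem norm_oscKernel {V : Type*} (φ : V → ℝ) (ψ : V → ℂ) (lam : ℝ) (p : V) :
    ‖oscKernel φ ψ lam p‖ = ‖ψ p‖ := by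
  have : 2 * (Real.pi : ℂ) * Complex.I * (lam : ℂ) * (φ p : ℂ) =
      ((2 * Real.pi * lam * φ p : ℝ) : ℂ) * Complex.I := by push_cast; ring
  rw [oscKernel, norm_mul, this, Complex.norm_exp_ofReal_mul_I, one_mul]

theorem continuous_oscKernel {V : Type*} [TopologicalSpace V] {φ : V → ℝ} (hφ : Continuous φ) {ψ : V → ℂ} (hψ : Continuous ψ)
    (lam : ℝ) : Continuous (oscKernel φ ψ lam) := by
  unfold oscKernel
  fun_prop

theorem hasCompactSupport_oscKernel {V : Type*} [TopologicalSpace V] (φ : V → ℝ) {ψ : V → ℂ}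
    (hψ : HasCompactSupport ψ) (lam : ℝ) :
    HasCompactSupport (oscKernel φ ψ lam) :=
  hψ.mul_left

open ComplexConjugate in
-- Moving `‖H‖` from the phase into the frequency makes `2πλ‖H‖` the large parameter and leaves a
-- difference quotient, whose derivatives stay bounded as `H → 0`.
theorem oscKernel_mul_conj {V : Type*} [NormedAddCommGroup V] (φ : V → ℝ) (ψ : V → ℂ) (lam : ℝ)
    {H : V} (hH : H ≠ 0) (p : V) :
    oscKernel φ ψ lam p * conj (oscKernel φ ψ lam (p + H)) =
      Complex.exp (Complex.I * (2 * Real.pi * lam * ‖H‖ : ℝ) *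
        (‖H‖⁻¹ • (φ p - φ (p + H)) : ℝ)) * (ψ p * conj (ψ (p + H))) := by
  have hH' : (‖H‖ : ℂ) ≠ 0 := by exact_mod_cast norm_ne_zero_iff.2 hH
  simp only [oscKernel, map_mul, ← Complex.exp_conj, Complex.conj_ofReal, Complex.conj_I,
    map_ofNat]
  rw [mul_mul_mul_comm, ← Complex.exp_add]
  congr 2
  push_cast [smul_eq_mul]
  field_simp
  ring

section Correlation

variable {V : Type*} [NormedAddCommGroup V] [NormedSpace ℝ V]

/-- Difference quotients of a smooth function form a uniformly smooth family. -/
theorem ContDiff.uniformSmooth_slope [FiniteDimensional ℝ V] {φ : V → ℝ} (hφ : ContDiff ℝ ∞ φ)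
    (p₀ : V) (r R : ℝ) :
    UniformSmooth (ι := {H : V // H ≠ 0 ∧ ‖H‖ ≤ R}) (Metric.closedBall p₀ r)
      fun H p => ‖H.1‖⁻¹ • (φ p - φ (p + H.1)) := by
  have hs (H : V) : ContDiff ℝ ∞ fun p => φ (p + H) := hφ.comp (contDiff_id.add contDiff_const)
  refine ⟨fun H => (hφ.sub (hs H.1)).const_smul ‖H.1‖⁻¹, fun k => ?_⟩
  obtain ⟨C, hC⟩ := hφ.exists_iteratedFDeriv_bound (isCompact_closedBall p₀ (r + R)) (k + 1)
  refine ⟨C, fun ⟨H, hH0, hHR⟩ p hp => ?_⟩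
  have hHpos : 0 < ‖H‖ := norm_pos_iff.2 hH0
  have hk : (k : WithTop ℕ∞) ≤ ((⊤ : ℕ∞) : WithTop ℕ∞) := by exact_mod_cast le_top
  have hd : iteratedFDeriv ℝ k (fun p => ‖H‖⁻¹ • (φ p - φ (p + H))) p =
      ‖H‖⁻¹ • (iteratedFDeriv ℝ k φ p - iteratedFDeriv ℝ k φ (p + H)) := by
    have h1 := iteratedFDeriv_const_smul_apply (𝕜 := ℝ) (a := ‖H‖⁻¹) (x := p) (i := k)
      (f := fun p => φ p - φ (p + H)) (((hφ.sub (hs H)).of_le hk).contDiffAt)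
    have h2 := iteratedFDeriv_sub_apply (𝕜 := ℝ) (x := p) (i := k)
      (f := φ) (g := fun p => φ (p + H)) ((hφ.of_le hk).contDiffAt) (((hs H).of_le hk).contDiffAt)
    rw [iteratedFDeriv_comp_add_right] at h2
    rw [← h2]
    exact h1
  have hdiff : Differentiable ℝ (iteratedFDeriv ℝ k φ) :=
    hφ.differentiable_iteratedFDeriv (by exact_mod_cast WithTop.coe_lt_top _)
  -- The mean value inequality on a ball containing both `p` and `p + H` gains the factor `‖H‖` that
  -- cancels `‖H‖⁻¹`, at the cost of one more derivative.
  have hmv := (convex_closedBall p₀ (r + R)).norm_image_sub_le_of_norm_fderiv_le (𝕜 := ℝ)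
    (f := iteratedFDeriv ℝ k φ) (C := C) (x := p + H) (y := p) (fun x _ => hdiff x)
    (fun x hx => by rw [norm_fderiv_iteratedFDeriv]; exact hC x hx)
    (by
      rw [mem_closedBall_iff_norm] at hp ⊢
      calc ‖p + H - p₀‖ = ‖(p - p₀) + H‖ := by congr 1; abel
        _ ≤ _ := (norm_add_le _ _).trans (add_le_add hp hHR))
    (Metric.closedBall_subset_closedBall (by linarith) hp)
  simp only
  rw [hd, norm_smul, norm_inv, norm_norm, inv_mul_le_iff₀ hHpos, mul_comm]
  simpa using hmv

/-- An injective linear map on a finite-dimensional space is bounded below, and `e` nearly attains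
the norm of `D H`. The factor 2 in the constant makes the inequality strict, as the operator norm
need not be attained inside the open ball. The sign matches the phase `φ(p) - φ(p + H)`. -/
theorem ContinuousLinearMap.exists_neg_le_apply [FiniteDimensional ℝ V]
    {D : V →L[ℝ] V →L[ℝ] ℝ} (hD : ∀ H, D H = 0 → H = 0) :
    ∃ c : ℝ, 0 < c ∧ ∀ H, ∃ e : V, ‖e‖ ≤ 1 ∧ c * ‖H‖ ≤ - D H e := by
  obtain ⟨K, hK, hanti⟩ := LinearMap.exists_antilipschitzWith (D : V →ₗ[ℝ] V →L[ℝ] ℝ)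
    (LinearMap.ker_eq_bot'.2 hD)
  have hK' : (0 : ℝ) < K := hK
  refine ⟨(2 * K)⁻¹, by positivity, fun H => ?_⟩
  rcases eq_or_ne H 0 with rfl | hH
  · exact ⟨0, by simp, by simp⟩
  have hb : ‖H‖ ≤ K * ‖D H‖ := by
    simpa using hanti.le_mul_dist H 0
  have hpos : 0 < ‖H‖ := norm_pos_iff.2 hH
  have hlt : (2 * K : ℝ)⁻¹ * ‖H‖ < ‖D H‖ := by
    rw [inv_mul_lt_iff₀ (by positivity)]
    nlinarith
  obtain ⟨x, hx1, hx⟩ := (D H).exists_lt_apply_of_lt_opNorm hlt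
  rcases le_total 0 (D H x) with h | h
  · refine ⟨-x, by simpa using hx1.le, ?_⟩
    rw [Real.norm_of_nonneg h] at hx
    simpa using hx.le
  · refine ⟨x, hx1.le, ?_⟩
    rw [Real.norm_of_nonpos h] at hx
    exact hx.le

open ComplexConjugate in
/-- Decay of the correlations of an oscillatory kernel supported near a point at which the Hessian
of the phase is nondegenerate. -/
theorem exists_correlation_bound [FiniteDimensional ℝ V] [MeasurableSpace V] [BorelSpace V]
    {μ : Measure V} [μ.IsAddHaarMeasure] {φ : V → ℝ} (hφ : ContDiff ℝ ∞ φ) {p₀ : V}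
    (hD : ∀ H, fderiv ℝ (fderiv ℝ φ) p₀ H = 0 → H = 0) :
    ∃ r > 0, ∀ ψ : V → ℂ, ContDiff ℝ ∞ ψ → tsupport ψ ⊆ Metric.closedBall p₀ r → ∀ N : ℕ,
      ∃ C : ℝ, ∀ lam : ℝ, 0 < lam → ∀ H : V, (1 + lam * ‖H‖) ^ N *
        ‖∫ p, oscKernel φ ψ lam p * conj (oscKernel φ ψ lam (p + H)) ∂μ‖ ≤ C := by
  obtain ⟨c, hc, hce⟩ := ContinuousLinearMap.exists_neg_le_apply hD
  choose e he1 he using hce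
  have hφ1 : ContDiff ℝ ∞ (fderiv ℝ φ) := hφ.fderiv_right (by simp)
  have hφ2 : Continuous (fderiv ℝ (fderiv ℝ φ)) := hφ1.continuous_fderiv (by simp)
  obtain ⟨δ, hδ, hδb⟩ := hφ2.exists_ball_norm_sub_lt (W := V →L[ℝ] V →L[ℝ] ℝ) p₀ (half_pos hc)
  -- For `p` within `r` of `p₀` and `‖H‖ ≤ 2r`, the point `p + H` is within `3r < δ`. There the
  -- second derivative differs from its value at `p₀` by less than `c / 2`, so half of the lower
  -- bound survives.
  refine ⟨δ / 4, by positivity, fun ψ hψ hψS N => ?_⟩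
  set r := δ / 4 with hr
  set S := Metric.closedBall p₀ r with hSdef
  have hS : IsCompact S := isCompact_closedBall _ _
  have hψc : HasCompactSupport ψ := hS.of_isClosed_subset (isClosed_tsupport _) hψS
  have hslope := hφ.uniformSmooth_slope p₀ r (2 * r)
  have hf : UniformSmooth (ι := {H : V // H ≠ 0 ∧ ‖H‖ ≤ 2 * r}) S
      fun H p => ψ p * conj (ψ (p + H.1)) := by
    have h1 : UniformSmooth (ι := {H : V // H ≠ 0 ∧ ‖H‖ ≤ 2 * r}) S fun _ => ψ :=
      ⟨fun _ => hψ, fun k => (hψ.exists_iteratedFDeriv_bound hS k).imp fun C hC _ => hC⟩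
    have hcj : ContDiff ℝ ∞ fun p => conj (ψ p) := Complex.conjCLE.contDiff.comp hψ
    have h2 : UniformSmooth (ι := {H : V // H ≠ 0 ∧ ‖H‖ ≤ 2 * r}) S
        fun H p => conj (ψ (p + H.1)) := by
      refine ⟨fun H => hcj.comp (contDiff_id.add contDiff_const), fun k => ?_⟩
      obtain ⟨C, hC⟩ := hcj.exists_iteratedFDeriv_bound (isCompact_closedBall p₀ (r + 2 * r)) k
      refine ⟨C, fun H p hp => ?_⟩
      rw [iteratedFDeriv_comp_add_right (f := fun p => conj (ψ p))]
      refine hC _ ?_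
      rw [hSdef, mem_closedBall_iff_norm] at hp
      rw [mem_closedBall_iff_norm]
      calc ‖p + H.1 - p₀‖ = ‖(p - p₀) + H.1‖ := by congr 1; abel
        _ ≤ _ := (norm_add_le _ _).trans (add_le_add hp H.2.2)
    exact h1.smul h2
  have hlow (H : {H : V // H ≠ 0 ∧ ‖H‖ ≤ 2 * r}) (p : V) (hp : p ∈ S) :
      c / 2 ≤ fderiv ℝ (fun p => ‖H.1‖⁻¹ • (φ p - φ (p + H.1))) p (e H.1) := by
    obtain ⟨H, hH0, hH⟩ := H
    have hpos : 0 < ‖H‖ := norm_pos_iff.2 hH0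
    have hd1 (x : V) : HasFDerivAt φ (fderiv ℝ φ x) x :=
      (hφ.differentiable (by simp) x).hasFDerivAt
    have hd : HasFDerivAt (fun p => ‖H‖⁻¹ • (φ p - φ (p + H)))
        (‖H‖⁻¹ • (fderiv ℝ φ p - fderiv ℝ φ (p + H))) p :=
      ((hd1 p).sub ((hasFDerivAt_comp_add_right H).2 (hd1 (p + H)))).const_smul ‖H‖⁻¹
    have hmv := (convex_ball p₀ δ).norm_image_sub_le_of_norm_fderiv_le' (𝕜 := ℝ)
      (f := fderiv ℝ φ) (φ := fderiv ℝ (fderiv ℝ φ) p₀) (C := c / 2) (x := p) (y := p + H)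
      (fun x _ => hφ1.differentiable (by simp) x)
      (fun x hx => (hδb x hx).le)
      (by
        rw [hSdef, mem_closedBall_iff_norm] at hp
        rw [mem_ball_iff_norm]
        linarith)
      (by
        rw [hSdef, mem_closedBall_iff_norm] at hp
        rw [mem_ball_iff_norm]
        calc ‖p + H - p₀‖ = ‖(p - p₀) + H‖ := by congr 1; abel
          _ ≤ r + 2 * r := (norm_add_le _ _).trans (add_le_add hp hH)
          _ < δ := by linarith)
    rw [add_sub_cancel_left] at hmv
    have h3 := (((fderiv ℝ φ (p + H) - fderiv ℝ φ p - fderiv ℝ (fderiv ℝ φ) p₀ H).le_of_opNorm_le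
      hmv (e H)).trans (mul_le_of_le_one_right (by positivity) (he1 H)))
    have h4 := (abs_le.1 h3).2
    have h5 := he H
    simp only [sub_apply] at h4
    simp only
    rw [hd.fderiv, smul_apply, sub_apply, smul_eq_mul,
      le_inv_mul_iff₀ hpos]
    linarith
  obtain ⟨C₁, hC₁⟩ := exists_bound_integral_exp_of_le_fderiv (μ := μ) hS hslope.contDiff
    (fun H => he1 H.1) (hslope.fderiv_apply fun H => he1 H.1) (half_pos hc) hlow N hf
    (fun H => (tsupport_mul_subset_left).trans hψS)
  obtain ⟨M, hM⟩ := hψ.continuous.bounded_above_of_compact_support hψc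
  set C₀ := (∫ p, ‖ψ p‖ ∂μ) * M with hC₀
  have hzero (lam : ℝ) (H : V) :
      ‖∫ p, oscKernel φ ψ lam p * conj (oscKernel φ ψ lam (p + H)) ∂μ‖ ≤ C₀ := by
    rw [hC₀, ← integral_mul_const]
    refine norm_integral_le_of_norm_le
      ((hψ.continuous.integrable_of_hasCompactSupport hψc).norm.mul_const _)
      (Filter.Eventually.of_forall fun p => ?_)
    rw [norm_mul, RCLike.norm_conj, norm_oscKernel, norm_oscKernel]
    gcongr
    exact hM _
  refine ⟨2 ^ N * (C₀ + max C₁ 0), fun lam hlam H => ?_⟩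
  set I := ‖∫ p, oscKernel φ ψ lam p * conj (oscKernel φ ψ lam (p + H)) ∂μ‖ with hI
  have hI0 : 0 ≤ I := norm_nonneg _
  have hx : 0 ≤ lam * ‖H‖ := by positivity
  have hmain : (lam * ‖H‖) ^ N * I ≤ C₀ + max C₁ 0 := by
    rcases eq_or_ne H 0 with rfl | hH0
    · have h0 : (lam * ‖(0 : V)‖) ^ N ≤ 1 := pow_le_one₀ hx (by simp)
      exact (mul_le_of_le_one_left hI0 h0).trans
        ((hzero lam 0).trans (le_add_of_nonneg_right (le_max_right _ _)))
    have hC₀0 : 0 ≤ C₀ := (norm_nonneg _).trans (hzero 1 0)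
    rcases le_or_gt ‖H‖ (2 * r) with hH | hH
    · have h1 := hC₁ ⟨H, hH0, hH⟩ (2 * Real.pi * lam * ‖H‖)
        (by have := norm_pos_iff.2 hH0; positivity)
      simp only [← oscKernel_mul_conj φ ψ lam hH0] at h1
      calc (lam * ‖H‖) ^ N * I ≤ (2 * Real.pi * lam * ‖H‖) ^ N * I := by
            gcongr
            exact le_mul_of_one_le_left hlam.le (by linarith [Real.pi_gt_three])
        _ ≤ C₁ := h1
        _ ≤ _ := (le_max_left _ _).trans (le_add_of_nonneg_left hC₀0)
    -- Both factors are supported in a set of diameter at most `2r`, so larger shifts make the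
    -- supports disjoint.
    · have hIz : I = 0 := by
        rw [hI, norm_eq_zero]
        refine integral_eq_zero_of_ae (Filter.Eventually.of_forall fun p => ?_)
        by_contra hne
        have hne' := mul_ne_zero_iff.1 hne
        have hp : p ∈ S := hψS (subset_tsupport _ (by
          have := norm_ne_zero_iff.2 hne'.1
          rw [norm_oscKernel] at this
          exact norm_ne_zero_iff.1 this))
        have hpH : p + H ∈ S := hψS (subset_tsupport _ (by
          have := norm_ne_zero_iff.2 hne'.2
          rw [RCLike.norm_conj, norm_oscKernel] at this
          exact norm_ne_zero_iff.1 this))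
        rw [hSdef, mem_closedBall_iff_norm] at hp hpH
        have : ‖H‖ ≤ r + r := by
          calc ‖H‖ = ‖(p + H - p₀) - (p - p₀)‖ := by congr 1; abel
            _ ≤ _ := (norm_sub_le _ _).trans (add_le_add hpH hp)
        linarith
      rw [hIz, mul_zero]
      positivity
  rcases le_total (lam * ‖H‖) 1 with h | h
  · calc (1 + lam * ‖H‖) ^ N * I ≤ 2 ^ N * C₀ := by
          gcongr
          · linarith
          · exact hzero lam H
      _ ≤ _ := by gcongr; exact le_add_of_nonneg_right (le_max_right _ _)
  · calc (1 + lam * ‖H‖) ^ N * I ≤ (2 * (lam * ‖H‖)) ^ N * I := by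
          gcongr
          linarith
      _ = 2 ^ N * ((lam * ‖H‖) ^ N * I) := by rw [mul_pow]; ring
      _ ≤ _ := by gcongr

end Correlation

/-! ### Localisation of the amplitude -/

open scoped Manifold in
/-- A smooth compactly supported function is a finite sum of smooth functions supported in small
balls. -/
theorem exists_sum_eq_of_hasCompactSupport {V : Type*} [NormedAddCommGroup V] [NormedSpace ℝ V]
    [FiniteDimensional ℝ V] {ψ : V → ℂ} (hψ : ContDiff ℝ ∞ ψ) (hψc : HasCompactSupport ψ)
    {r : tsupport ψ → ℝ} (hr : ∀ p, 0 < r p) :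
    ∃ (t : Finset (tsupport ψ)) (Ψ : t → V → ℂ), (∀ i, ContDiff ℝ ∞ (Ψ i)) ∧
      (∀ i, HasCompactSupport (Ψ i)) ∧
      (∀ i, tsupport (Ψ i) ⊆ Metric.closedBall i.1.1 (r i.1)) ∧ ∑ i, Ψ i = ψ := by
  obtain ⟨t, ht⟩ := hψc.isCompact.elim_finite_subcover
    (fun p : tsupport ψ => Metric.ball p.1 (r p)) (fun _ => Metric.isOpen_ball)
    fun p hp => Set.mem_iUnion.2 ⟨⟨p, hp⟩, Metric.mem_ball_self (hr _)⟩
  obtain ⟨χ, hχ⟩ := SmoothPartitionOfUnity.exists_isSubordinate 𝓘(ℝ, V)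
    (isClosed_tsupport ψ) (fun i : t => Metric.ball i.1.1 (r i.1)) (fun _ => Metric.isOpen_ball)
    (by
      intro p hp
      obtain ⟨i, hi, hpi⟩ := Set.mem_iUnion₂.1 (ht hp)
      exact Set.mem_iUnion.2 ⟨⟨i, hi⟩, hpi⟩)
  refine ⟨t, fun i p => χ i p • ψ p, fun i => (χ i).contMDiff.contDiff.smul hψ,
    fun i => hψc.of_isClosed_subset (isClosed_tsupport _) (tsupport_smul_subset_right _ _),
    fun i => ?_, ?_⟩
  · exact (tsupport_smul_subset_left _ _).trans ((hχ i).trans Metric.ball_subset_closedBall)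
  · ext p
    rw [Finset.sum_apply, ← Finset.sum_smul]
    by_cases hp : p ∈ tsupport ψ
    · have h1 := χ.sum_eq_one hp
      rw [finsum_eq_sum_of_fintype] at h1
      rw [h1, one_smul]
    · rw [image_eq_zero_of_notMem_tsupport hp, smul_zero]

/-! ### Decay of the partial Fourier transforms -/

section PartialFourier

variable {E : Type*} [NormedAddCommGroup E] [InnerProductSpace ℝ E]
  [FiniteDimensional ℝ E] [MeasurableSpace E] [BorelSpace E]

open scoped FourierTransform ComplexConjugate

/-- The `L²` norm of a partial Fourier transform of `K` along the diagonal direction is controlled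
by the correlations of `K` with its diagonal translates. -/
theorem lintegral_fourier_sq_le_correlation {K : E × E → ℂ} (hK : Continuous K)
    (hKc : HasCompactSupport K) (ζ : E) :
    ∫⁻ w, ‖𝓕 (fun v => K (w + v, v)) ζ‖ₑ ^ 2 ≤ ∫⁻ h, ‖∫ p, K p * conj (K (p + (h, h)))‖ₑ := by
  set k : E × E → ℂ := fun q => Real.fourierChar (-inner ℝ q.2 ζ) • K (q.1 + q.2, q.2) with hk
  have hkcont : Continuous k :=
    (Real.continuous_fourierChar.comp (by fun_prop)).smul (hK.comp (by fun_prop))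
  obtain ⟨R, hR⟩ := hKc.isCompact.isBounded.subset_closedBall (0 : E × E)
  have hk0 (q : E × E) (hq : k q ≠ 0) : ‖q.1‖ ≤ R + R ∧ ‖q.2‖ ≤ R := by
    have h1 : K (q.1 + q.2, q.2) ≠ 0 := fun h0 => hq (by simp [hk, h0])
    have h2 := hR (subset_tsupport _ h1)
    rw [mem_closedBall_zero_iff, Prod.norm_def, sup_le_iff] at h2
    refine ⟨?_, h2.2⟩
    calc ‖q.1‖ = ‖(q.1 + q.2) - q.2‖ := by congr 1; abel
      _ ≤ _ := (norm_sub_le _ _).trans (add_le_add h2.1 h2.2)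
  set Ψ : (E × E) × E → ℂ := fun z => k z.1 * conj (k (z.1.1, z.1.2 + z.2)) with hΨ
  have hΨcont : Continuous Ψ := by
    refine (hkcont.comp continuous_fst).mul (Complex.continuous_conj.comp (hkcont.comp ?_))
    fun_prop
  have hΨc : HasCompactSupport Ψ := by
    refine HasCompactSupport.intro (K := Metric.closedBall 0 (R + R))
      (isCompact_closedBall _ _) fun z hz => ?_
    by_contra hne
    have hne' := mul_ne_zero_iff.1 hne
    obtain ⟨h1, h2⟩ := hk0 _ hne'.1
    obtain ⟨-, h3⟩ := hk0 _ fun h0 => hne'.2 (by rw [h0, map_zero])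
    apply hz
    have hR0 : 0 ≤ R := (norm_nonneg _).trans h2
    rw [mem_closedBall_zero_iff, Prod.norm_def, Prod.norm_def, sup_le_iff, sup_le_iff]
    refine ⟨⟨h1, h2.trans (le_add_of_nonneg_left hR0)⟩, ?_⟩
    calc ‖z.2‖ = ‖(z.1.2 + z.2) - z.1.2‖ := by congr 1; abel
      _ ≤ _ := (norm_sub_le _ _).trans (add_le_add h3 h2)
  have hΨi : Integrable Ψ := hΨcont.integrable_of_hasCompactSupport hΨc
  set F : E → ℂ := fun w => 𝓕 (fun v => K (w + v, v)) ζ with hF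
  have hFk (w : E) : F w = ∫ v, k (w, v) := Real.fourier_eq _ _
  have hFF (w : E) : F w * conj (F w) = ∫ v, ∫ h, Ψ ((w, v), h) := by
    have h1 (v : E) : ∫ h, Ψ ((w, v), h) = k (w, v) * conj (F w) := by
      simp only [hΨ]
      rw [integral_const_mul, hFk, ← integral_conj,
        integral_add_left_eq_self (fun v' => conj (k (w, v')))]
    simp only [h1]
    rw [integral_mul_const, ← hFk]
  rw [Measure.volume_eq_prod] at hΨi
  have hΨi1 := hΨi.integral_prod_left
  rw [Measure.volume_eq_prod] at hΨi1
  have hFFi : Integrable fun w => F w * conj (F w) := by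
    simp only [hFF]
    exact hΨi1.integral_prod_left
  have hswap : ∫ w, F w * conj (F w) = ∫ h, ∫ q, Ψ (q, h) := by
    simp only [hFF]
    rw [← integral_integral_swap (f := fun q h => Ψ (q, h)) hΨi, Measure.volume_eq_prod,
      integral_prod _ hΨi1]
  have hS := measurePreserving_add_prod (volume : Measure E) (volume : Measure E)
  -- Shifting `v` by `h` at fixed `w` shifts `(w + v, v)` by `(h, h)`. The characters at `v` and `v
  -- + h` combine to one depending on `h` alone, so the absolute value is independent of `ζ`.
  have hcorr (h : E) : ∫ q, Ψ (q, h) =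
      Real.fourierChar (inner ℝ h ζ) • ∫ p, K p * conj (K (p + (h, h))) := by
    have hcont : Continuous fun p => K p * conj (K (p + (h, h))) :=
      hK.mul (Complex.continuous_conj.comp (hK.comp (by fun_prop)))
    have h1 : ∫ p, K p * conj (K (p + (h, h))) =
        ∫ q : E × E, K (q.1 + q.2, q.2) * conj (K ((q.1 + q.2, q.2) + (h, h))) := by
      conv_lhs => rw [Measure.volume_eq_prod, ← hS.map_eq]
      rw [integral_map hS.measurable.aemeasurable hcont.aestronglyMeasurable]
      rfl
    rw [h1, Circle.smul_def, smul_eq_mul, ← integral_const_mul]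
    congr 1 with q
    simp only [hΨ, hk, Circle.smul_def, smul_eq_mul, map_mul, Prod.mk_add_mk, add_assoc]
    rw [mul_mul_mul_comm, ← Circle.coe_inv_eq_conj, ← Circle.coe_mul, ← AddChar.map_neg_eq_inv,
      ← AddChar.map_add_eq_mul, inner_add_left]
    congr 4
    ring
  have hnorm (w : E) : F w * conj (F w) = ((‖F w‖ ^ 2 : ℝ) : ℂ) := by
    rw [Complex.mul_conj, Complex.normSq_eq_norm_sq]
  have hsqi : Integrable fun w => ‖F w‖ ^ 2 := by
    refine hFFi.norm.congr (Filter.Eventually.of_forall fun w => ?_)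
    simp [sq]
  calc ∫⁻ w, ‖F w‖ₑ ^ 2 = ∫⁻ w, ENNReal.ofReal (‖F w‖ ^ 2) := by
        simp only [ENNReal.ofReal_pow (norm_nonneg _), ofReal_norm]
    _ = ENNReal.ofReal (∫ w, ‖F w‖ ^ 2) :=
        (ofReal_integral_eq_lintegral_ofReal hsqi
          (Filter.Eventually.of_forall fun w => by positivity)).symm
    _ = ‖∫ w, F w * conj (F w)‖ₑ := by
        simp only [hnorm]
        rw [integral_complex_ofReal, ← ofReal_norm, Complex.norm_real,
          Real.norm_of_nonneg (integral_nonneg fun w => by positivity)]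
    _ ≤ ∫⁻ h, ‖∫ q, Ψ (q, h)‖ₑ := by
        rw [hswap]
        exact enorm_integral_le_lintegral_enorm _
    _ = _ := by
        simp only [hcorr, Circle.smul_def, enorm_smul]
        congr 1 with h
        rw [← ofReal_norm, Circle.norm_coe, ENNReal.ofReal_one, one_mul]

/-- Rescaling `h` by `lam` produces the power of `lam`; the exponent `n + 1` is the first integer
for which the rescaled integral converges. -/
theorem lintegral_one_add_mul_norm_pow {lam : ℝ} (hlam : 0 < lam) (C : ℝ) :
    ∫⁻ h : E, ENNReal.ofReal (C / (1 + lam * ‖h‖) ^ (Module.finrank ℝ E + 1)) ≤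
      ENNReal.ofReal ((|C| * ∫ h : E, (1 + ‖h‖) ^ (-((Module.finrank ℝ E : ℝ) + 1))) *
        lam ^ (-(Module.finrank ℝ E : ℝ))) := by
  set n := Module.finrank ℝ E with hn
  have hint : Integrable fun h : E => (1 + ‖h‖) ^ (-((n : ℝ) + 1)) :=
    integrable_one_add_norm (by simp [hn])
  have hrw (h : E) : |C| / (1 + lam * ‖h‖) ^ (n + 1) =
      |C| * (fun y : E => (1 + ‖y‖) ^ (-((n : ℝ) + 1))) (lam • h) := by
    have : (0 : ℝ) ≤ 1 + lam * ‖h‖ := by positivity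
    simp only [norm_smul, Real.norm_of_nonneg hlam.le]
    rw [Real.rpow_neg this, div_eq_mul_inv]
    congr 2
    exact_mod_cast (Real.rpow_natCast _ (n + 1)).symm
  calc _ ≤ ∫⁻ h : E, ENNReal.ofReal (|C| / (1 + lam * ‖h‖) ^ (n + 1)) := by
        refine lintegral_mono fun h => ENNReal.ofReal_le_ofReal ?_
        gcongr
        exact le_abs_self C
    _ = ENNReal.ofReal (∫ h : E, |C| / (1 + lam * ‖h‖) ^ (n + 1)) := by
        rw [ofReal_integral_eq_lintegral_ofReal]
        · simp only [hrw]
          exact (hint.comp_smul hlam.ne').const_mul _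
        · exact Filter.Eventually.of_forall fun h => by positivity
    _ = _ := by
        have hscale : ∫ h : E, (1 + ‖lam • h‖) ^ (-((n : ℝ) + 1)) =
            |(lam ^ n)⁻¹| • ∫ h : E, (1 + ‖h‖) ^ (-((n : ℝ) + 1)) :=
          Measure.integral_comp_smul volume (fun y : E => (1 + ‖y‖) ^ (-((n : ℝ) + 1))) lam
        simp only [hrw]
        rw [integral_const_mul, hscale, abs_of_pos (inv_pos.2 (pow_pos hlam n)),
          Real.rpow_neg hlam.le, Real.rpow_natCast, smul_eq_mul]
        congr 1
        ring

/-- `PartialFourierDecay φ ψ`: the partial Fourier transforms of the kernels `e^{2 π i lam φ} ψ`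
have `L²` norm squared of order `lam⁻ⁿ`, where `n` is the dimension. -/
def PartialFourierDecay (φ : E × E → ℝ) (ψ : E × E → ℂ) : Prop :=
  ∃ C : ℝ, 0 ≤ C ∧ ∀ lam : ℝ, 0 < lam → ∀ ζ : E,
    ∫⁻ w, ‖𝓕 (fun v => oscKernel φ ψ lam (w + v, v)) ζ‖ₑ ^ 2 ≤
      ENNReal.ofReal (C * lam ^ (-(Module.finrank ℝ E : ℝ)))

theorem exists_partialFourierDecay {φ : E × E → ℝ} (hφ : ContDiff ℝ ∞ φ) {p₀ : E × E}
    (hD : ∀ H, fderiv ℝ (fderiv ℝ φ) p₀ H = 0 → H = 0) :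
    ∃ r > 0, ∀ ψ : E × E → ℂ, ContDiff ℝ ∞ ψ → tsupport ψ ⊆ Metric.closedBall p₀ r →
      PartialFourierDecay φ ψ := by
  have : (volume : Measure (E × E)).IsAddHaarMeasure := by
    rw [Measure.volume_eq_prod]; infer_instance
  obtain ⟨r, hr, hcor⟩ := exists_correlation_bound (μ := (volume : Measure (E × E))) hφ hD
  refine ⟨r, hr, fun ψ hψ hψr => ?_⟩
  obtain ⟨C, hC⟩ := hcor ψ hψ hψr (Module.finrank ℝ E + 1)
  have hψc : HasCompactSupport ψ :=
    (isCompact_closedBall p₀ r).of_isClosed_subset (isClosed_tsupport _) hψr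
  refine ⟨|C| * ∫ h : E, (1 + ‖h‖) ^ (-((Module.finrank ℝ E : ℝ) + 1)),
    mul_nonneg (abs_nonneg _) (integral_nonneg fun h => by positivity), fun lam hlam ζ => ?_⟩
  refine (lintegral_fourier_sq_le_correlation
    (continuous_oscKernel hφ.continuous hψ.continuous lam)
    (hasCompactSupport_oscKernel φ hψc lam) ζ).trans (le_trans ?_
    (lintegral_one_add_mul_norm_pow hlam C))
  refine lintegral_mono fun h => ?_
  rw [← ofReal_norm]
  refine ENNReal.ofReal_le_ofReal ?_
  rw [le_div_iff₀' (by positivity)]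
  -- In the sup norm of the product, `(h, h)` has norm `‖h‖`.
  simpa [Prod.norm_def] using hC lam hlam (h, h)

theorem integrable_diagonal_slice {K : E × E → ℂ} (hK : Continuous K)
    (hKc : HasCompactSupport K) (w : E) : Integrable fun v => K (w + v, v) := by
  obtain ⟨R, hR⟩ := hKc.isCompact.isBounded.subset_closedBall (0 : E × E)
  refine (hK.comp (by fun_prop)).integrable_of_hasCompactSupport <|
    HasCompactSupport.intro (isCompact_closedBall (0 : E) R) fun v hv => ?_
  by_contra hne
  have h := hR (subset_tsupport _ hne)
  rw [mem_closedBall_zero_iff, Prod.norm_def, sup_le_iff] at h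
  exact hv (mem_closedBall_zero_iff.2 h.2)

theorem PartialFourierDecay.add {φ : E × E → ℝ} (hφ : Continuous φ) {ψ₁ ψ₂ : E × E → ℂ}
    (h₁ : Continuous ψ₁) (hc₁ : HasCompactSupport ψ₁) (h₂ : Continuous ψ₂)
    (hc₂ : HasCompactSupport ψ₂) (hd₁ : PartialFourierDecay φ ψ₁)
    (hd₂ : PartialFourierDecay φ ψ₂) : PartialFourierDecay φ (ψ₁ + ψ₂) := by
  obtain ⟨C₁, hC₁0, hC₁⟩ := hd₁
  obtain ⟨C₂, hC₂0, hC₂⟩ := hd₂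
  refine ⟨2 * (C₁ + C₂), by positivity, fun lam hlam ζ => ?_⟩
  have hsum (w : E) : 𝓕 (fun v => oscKernel φ (ψ₁ + ψ₂) lam (w + v, v)) ζ =
      𝓕 (fun v => oscKernel φ ψ₁ lam (w + v, v)) ζ +
        𝓕 (fun v => oscKernel φ ψ₂ lam (w + v, v)) ζ := by
    have h := congrFun (VectorFourier.fourierIntegral_add (μ := (volume : Measure E))
      (L := innerₗ E) Real.continuous_fourierChar continuous_inner
      (integrable_diagonal_slice (continuous_oscKernel hφ h₁ lam)
        (hasCompactSupport_oscKernel φ hc₁ lam) w)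
      (integrable_diagonal_slice (continuous_oscKernel hφ h₂ lam)
        (hasCompactSupport_oscKernel φ hc₂ lam) w)) ζ
    refine Eq.trans (congrArg (fun G : E → ℂ => 𝓕 G ζ) ?_) h
    funext v
    simp [oscKernel, mul_add]
  have hm : Measurable fun w => ‖𝓕 (fun v => oscKernel φ ψ₁ lam (w + v, v)) ζ‖ₑ ^ 2 :=
    ((stronglyMeasurable_fourier_slice (continuous_oscKernel hφ h₁ lam)).comp_measurable
    (measurable_prodMk_left (x := ζ))).enorm.pow_const 2
  calc _ ≤ ∫⁻ w, 2 * (‖𝓕 (fun v => oscKernel φ ψ₁ lam (w + v, v)) ζ‖ₑ ^ 2 +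
        ‖𝓕 (fun v => oscKernel φ ψ₂ lam (w + v, v)) ζ‖ₑ ^ 2) := by
        refine lintegral_mono fun w => ?_
        rw [hsum]
        simp only [← ofReal_norm, ← ENNReal.ofReal_pow (norm_nonneg _)]
        rw [← ENNReal.ofReal_add (by positivity) (by positivity), ← ENNReal.ofReal_ofNat,
          ← ENNReal.ofReal_mul (by norm_num)]
        refine ENNReal.ofReal_le_ofReal ?_
        refine (pow_le_pow_left₀ (norm_nonneg _) (norm_add_le _ _) 2).trans add_sq_le
    _ ≤ 2 * (ENNReal.ofReal (C₁ * lam ^ (-(Module.finrank ℝ E : ℝ))) +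
        ENNReal.ofReal (C₂ * lam ^ (-(Module.finrank ℝ E : ℝ)))) := by
        rw [lintegral_const_mul' _ _ (by norm_num), lintegral_add_left hm]
        gcongr
        · exact hC₁ lam hlam ζ
        · exact hC₂ lam hlam ζ
    _ = _ := by
        rw [← ENNReal.ofReal_add (by positivity) (by positivity), ← ENNReal.ofReal_ofNat,
          ← ENNReal.ofReal_mul (by norm_num)]
        congr 1
        ring

theorem PartialFourierDecay.sum {ι : Type*} {φ : E × E → ℝ} (hφ : Continuous φ)
    {ψ : ι → E × E → ℂ} (h : ∀ i, Continuous (ψ i)) (hc : ∀ i, HasCompactSupport (ψ i))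
    (hd : ∀ i, PartialFourierDecay φ (ψ i)) (s : Finset ι) :
    PartialFourierDecay φ (∑ i ∈ s, ψ i) := by
  -- Adding one more term requires continuity and compact support of the partial sum, so these are
  -- carried through the induction.
  suffices Continuous (∑ i ∈ s, ψ i) ∧ HasCompactSupport (∑ i ∈ s, ψ i) ∧
    PartialFourierDecay φ (∑ i ∈ s, ψ i) from this.2.2
  classical
  induction s using Finset.induction_on with
  | empty =>
    rw [Finset.sum_empty]
    exact ⟨continuous_zero, HasCompactSupport.zero, 0, le_rfl, fun lam _ ζ => by
      simp [oscKernel, Real.fourier_eq]⟩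
  | insert i s hi ih =>
    rw [Finset.sum_insert hi]
    exact ⟨(h i).add ih.1, (hc i).add ih.2.1, (hd i).add hφ (h i) (hc i) ih.1 ih.2.1 ih.2.2⟩

/-- The decay of the partial Fourier transforms under the nondegeneracy of the Hessian of the phase
on the support of the amplitude. -/
theorem partialFourierDecay_of_nondegenerate {φ : E × E → ℝ} (hφ : ContDiff ℝ ∞ φ)
    {ψ : E × E → ℂ} (hψ : ContDiff ℝ ∞ ψ) (hψc : HasCompactSupport ψ)
    (hD : ∀ p ∈ tsupport ψ, ∀ H, fderiv ℝ (fderiv ℝ φ) p H = 0 → H = 0) :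
    PartialFourierDecay φ ψ := by
  have hloc (p : tsupport ψ) := exists_partialFourierDecay hφ (hD p.1 p.2)
  choose r hr hdec using hloc
  obtain ⟨t, Ψ, hΨ, hΨc, hΨr, hsum⟩ := exists_sum_eq_of_hasCompactSupport hψ hψc hr
  rw [← hsum]
  exact PartialFourierDecay.sum hφ.continuous (fun i => (hΨ i).continuous) hΨc
    (fun i => hdec i.1 _ (hΨ i) (hΨr i)) _

end PartialFourier

/-! ### The Hessian matrix and the conclusion -/

theorem eq_sum_smul_coordDir {d : ℕ} (H : EuclideanSpace ℝ (Fin d) × EuclideanSpace ℝ (Fin d)) :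
    H = ∑ i, (Sum.elim (fun i => H.1 i) (fun i => H.2 i) : Fin d ⊕ Fin d → ℝ) i •
      coordDir d i := by
  have hs (i x : Fin d) : (Pi.single x (1 : ℝ) : Fin d → ℝ) i = if i = x then 1 else 0 :=
    Pi.single_apply ..
  rw [Fintype.sum_sum_type]
  ext i
  · simp [coordDir, Prod.fst_sum, hs]
  · simp [coordDir, Prod.snd_sum, hs]

/-- The coordinate vector of `H` lies in the left kernel of the Hessian matrix. This turns the
determinant condition into the coordinate-free injectivity used above. -/
theorem eq_zero_of_fderiv_fderiv_eq_zero {d : ℕ}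
    {φ : EuclideanSpace ℝ (Fin d) × EuclideanSpace ℝ (Fin d) → ℝ} (hφ : ContDiff ℝ ∞ φ)
    {p H : EuclideanSpace ℝ (Fin d) × EuclideanSpace ℝ (Fin d)}
    (hdet : (hessianMatrix φ p).det ≠ 0) (hH : fderiv ℝ (fderiv ℝ φ) p H = 0) : H = 0 := by
  have hφ1 : ContDiff ℝ ∞ (fderiv ℝ φ) := hφ.fderiv_right (by simp)
  have hentry (i j : Fin d ⊕ Fin d) : hessianMatrix φ p i j =
      fderiv ℝ (fderiv ℝ φ) p (coordDir d i) (coordDir d j) := by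
    rw [hessianMatrix, Matrix.of_apply,
      fderiv_clm_apply (hφ1.differentiable (by simp) p) (differentiableAt_const _)]
    simp
  set a : Fin d ⊕ Fin d → ℝ := Sum.elim (fun i => H.1 i) (fun i => H.2 i) with ha
  have hexp : H = ∑ i, a i • coordDir d i := eq_sum_smul_coordDir H
  have hmul : Matrix.vecMul a (hessianMatrix φ p) = 0 := by
    ext j
    have h := congrArg (fun T => T (coordDir d j)) hH
    rw [hexp] at h
    simpa [Matrix.vecMul, dotProduct, hentry] using h
  have ha0 := Matrix.eq_zero_of_vecMul_eq_zero hdet hmul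
  rw [hexp, ha0]
  simp

theorem corollary5p5 (d : ℕ) (hd : 1 ≤ d)
    (φ : EuclideanSpace ℝ (Fin d) × EuclideanSpace ℝ (Fin d) → ℝ) (hφ : ContDiff ℝ ∞ φ)
    (ψ : EuclideanSpace ℝ (Fin d) × EuclideanSpace ℝ (Fin d) → ℂ) (hψ : ContDiff ℝ ∞ ψ)
    (hψc : HasCompactSupport ψ)
    (hdet : ∀ p ∈ tsupport ψ, (hessianMatrix φ p).det ≠ 0) :
    ∃ C : ℝ, 0 < C ∧ ∀ lam : ℝ, 0 < lam → ∀ f g : EuclideanSpace ℝ (Fin d) → ℂ,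
      MemLp f 2 volume → MemLp g 2 volume →
        (∀ x, Integrable (oscIntegrand φ ψ lam f g x) volume) ∧
        MemLp (bilinearOsc φ ψ lam f g) 2 volume ∧
        eLpNorm (bilinearOsc φ ψ lam f g) 2 volume ≤
          ENNReal.ofReal (C * lam ^ (-(d : ℝ) / 2)) * eLpNorm f 2 volume * eLpNorm g 2 volume := by
  obtain ⟨C, hC0, hC⟩ := partialFourierDecay_of_nondegenerate hφ hψ hψc
    fun p hp H hH => eq_zero_of_fderiv_fderiv_eq_zero hφ (hdet p hp) hH
  -- The decay estimate bounds the square of the norm, whence the root; adding 1 keeps the constant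
  -- positive when `C = 0`.
  refine ⟨√C + 1, by positivity, fun lam hlam f g hf hg => ?_⟩
  have hK := continuous_oscKernel hφ.continuous hψ.continuous lam
  have hKc := hasCompactSupport_oscKernel φ hψc lam
  obtain ⟨f', hf'm, hff'⟩ := hf.1
  obtain ⟨g', hg'm, hgg'⟩ := hg.1
  have hf' : MemLp f' 2 := (memLp_congr_ae hff').1 hf
  have hg' : MemLp g' 2 := (memLp_congr_ae hgg').1 hg
  -- For every `x`, the maps `p ↦ x - p.1` and `p ↦ x - p.2` pull null sets back to null sets.
  -- Measurable representatives therefore give the same operator at every point, not just almost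
  -- everywhere.
  have hae (x : EuclideanSpace ℝ (Fin d)) : oscIntegrand φ ψ lam f g x =ᵐ[volume]
      fun p => f' (x - p.1) * g' (x - p.2) * oscKernel φ ψ lam p := by
    have h1 := (Measure.measurePreserving_sub_left
      (volume : Measure (EuclideanSpace ℝ (Fin d))) x).quasiMeasurePreserving
    have hfx := (h1.comp (Measure.quasiMeasurePreserving_fst (μ := volume)
      (ν := (volume : Measure (EuclideanSpace ℝ (Fin d)))))).ae_eq_comp hff'
    have hgx := (h1.comp (Measure.quasiMeasurePreserving_snd
      (μ := (volume : Measure (EuclideanSpace ℝ (Fin d)))) (ν := volume))).ae_eq_comp hgg'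
    rw [Measure.volume_eq_prod]
    filter_upwards [hfx, hgx] with p hp1 hp2
    simp only [Function.comp_apply] at hp1 hp2
    rw [oscIntegrand, oscKernel, hp1, hp2, mul_assoc]
  have hT : bilinearOsc φ ψ lam f g = bilinearConv (oscKernel φ ψ lam) f' g' := by
    ext x
    exact integral_congr_ae (hae x)
  refine ⟨fun x => (integrable_congr (hae x)).2
    (integrable_translates_mul hf'm hg'm hf' hg' hK hKc x), ?_, ?_⟩
  · rw [hT]
    exact memLp_bilinearConv hK hKc hf'm hg'm hf' hg'
  · rw [hT, eLpNorm_congr_ae hff', eLpNorm_congr_ae hgg',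
      ← ENNReal.pow_le_pow_left_iff (n := 2) two_ne_zero, mul_pow, mul_pow, mul_assoc]
    refine (eLpNorm_bilinearConv_sq_le hK hKc (hC lam hlam) hf'm hg'm hf' hg').trans ?_
    gcongr
    rw [← ENNReal.ofReal_pow (by positivity), finrank_euclideanSpace_fin]
    refine ENNReal.ofReal_le_ofReal ?_
    rw [mul_pow, ← Real.rpow_natCast (lam ^ _), ← Real.rpow_mul hlam.le]
    have h1 : -(d : ℝ) / 2 * (2 : ℕ) = -d := by push_cast; ring
    rw [h1]
    gcongr
    nlinarith [Real.sq_sqrt hC0, Real.sqrt_nonneg C]
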